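/- Let $n\ge 0$ be an integer and let $S=\mathbb C[x_0,\dots,x_n]$. For a collection $\mathcal F=\{F_j\}_{j\in J}$ of forms (homogeneous polynomials, possibly of different degrees) in $S$, the simultaneous Waring rank $\operatorname{rk}_{\mathbb C}\mathcal F$ is the minimal integer $r$ for which there are linear forms $L_1,\dots,L_r\in S$ such that every $F_j$ can be written as $F_j=\sum_{k=1}^r\lambda_{j,k}L_k^{\deg F_j}$ with $\lambda_{j,k}\in\mathbb C$; for a single form $F$ write $\operatorname{rk}_{\mathbb C}F=\operatorname{rk}_{\mathbb C}\{F\}$. Let $\mathcal M=\{M_j\}_{j\in J}$ be a finite collection of monomials $$M_j=x_0\,x_1^{a_{1,j}}\cdots x_n^{a_{n,j}},\qquad a_{i,j}\ge 1\ \text{ for all } i\in\{1,\dots,n\},\ j\in J.$$ Assume that $\mathcal M$ is $(1,1)$-free, that is: for every $i\in\{1,\dots,n\}$, if the exponents $a_{i,j}$, $j\in J$, are listed with repetitions in increasing order $a_{i,k_1}\le a_{i,k_2}\le\cdots\le a_{i,k_{|J|}}$, then the multiset of successive differences $a_{i,k_{s+1}}-a_{i,k_s}$ $(1\le s<|J|)$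 contains the number $1$ at most once. For a nonempty subset $K\subseteq J$ let $M_K=\gcd(M_j: j\in K)$. Then $\mathcal M$ and all the monomials $M_K$ admit decompositions as above (so that their ranks are defined), and $$\operatorname{rk}_{\mathbb C}\mathcal M=\sum_{\emptyset\ne K\subseteq J}(-1)^{|K|+1}\operatorname{rk}_{\mathbb C}M_K .$$ -/

import Mathlib

open MvPolynomial

noncomputable section

/-- The forms `F i` (`i : ι`) in `ℂ[x₀, …, xₙ]` can be written simultaneously with `r` linear forms:
there are linear forms `L₁, …, L_r` such that every `F i` is a complex linear combination of
`L₁ ^ d, …, L_r ^ d` with `d = deg (F i)`. The coefficients may depend on `i`, the `L k` may not,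
and the degrees of the `F i` may differ. -/
def HasSimultaneousDecomposition {ι : Type*} {n : ℕ}
    (F : ι → MvPolynomial (Fin (n + 1)) ℂ) (r : ℕ) : Prop :=
  ∃ L : Fin r → MvPolynomial (Fin (n + 1)) ℂ, (∀ k, (L k).IsHomogeneous 1) ∧
    ∀ i, ∃ c : Fin r → ℂ, F i = ∑ k, C (c k) * L k ^ (F i).totalDegree

/-- The simultaneous Waring rank over `ℂ` of a collection of forms. -/
def simultaneousWaringRank {ι : Type*} {n : ℕ}
    (F : ι → MvPolynomial (Fin (n + 1)) ℂ) : ℕ :=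
  sInf {r | HasSimultaneousDecomposition F r}

/-- The Waring rank over `ℂ` of a single form. -/
def waringRank {n : ℕ} (F : MvPolynomial (Fin (n + 1)) ℂ) : ℕ :=
  simultaneousWaringRank (fun _ : Unit => F)

/-- The monomial `x₀ x₁ ^ b₁ ⋯ xₙ ^ bₙ`; the exponent of `x_{i+1}` is `b i`. -/
def starMonomial {n : ℕ} (b : Fin n → ℕ) : MvPolynomial (Fin (n + 1)) ℂ :=
  X 0 * ∏ i : Fin n, X i.succ ^ b i

/-- The greatest common divisor of the monomials `x₀ x₁ ^ (a j 1) ⋯ xₙ ^ (a j n)`, `j ∈ K`: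
each exponent is the minimum over `K`. See `gcdStarMonomial_dvd` and `dvd_gcdStarMonomial`. -/
def gcdStarMonomial {ι : Type*} {n : ℕ} (a : ι → Fin n → ℕ) (K : Finset ι) (hK : K.Nonempty) :
    MvPolynomial (Fin (n + 1)) ℂ :=
  starMonomial (fun i => K.inf' hK (fun j => a j i))

/-- The displayed polynomial is the monomial with exponent vector `(1, b)`. -/
theorem starMonomial_eq_monomial {n : ℕ} (b : Fin n → ℕ) :
    starMonomial b =
      monomial (Finsupp.equivFunOnFinite.symm (Fin.cons 1 b : Fin (n + 1) → ℕ)) 1 := by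
  rw [monomial_eq, Finsupp.prod_fintype _ _ (fun i => pow_zero _), Fin.prod_univ_succ]
  simp [starMonomial]

/-- `gcdStarMonomial` divides each of the monomials. -/
theorem gcdStarMonomial_dvd {ι : Type*} {n : ℕ} (a : ι → Fin n → ℕ) (K : Finset ι)
    (hK : K.Nonempty) {j : ι} (hj : j ∈ K) : gcdStarMonomial a K hK ∣ starMonomial (a j) := by
  unfold gcdStarMonomial starMonomial
  exact mul_dvd_mul_left _ (Finset.prod_dvd_prod_of_dvd _ _ fun i _ =>
    pow_dvd_pow _ (Finset.inf'_le (fun j => a j i) hj))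

/-- Every polynomial dividing all the monomials divides `gcdStarMonomial`. -/
theorem dvd_gcdStarMonomial {ι : Type*} {n : ℕ} (a : ι → Fin n → ℕ) (K : Finset ι)
    (hK : K.Nonempty) (p : MvPolynomial (Fin (n + 1)) ℂ)
    (hp : ∀ j ∈ K, p ∣ starMonomial (a j)) : p ∣ gcdStarMonomial a K hK := by
  obtain ⟨j₀, hj₀⟩ := hK
  have h0 := hp j₀ hj₀
  rw [starMonomial_eq_monomial, dvd_monomial_iff_exists one_ne_zero] at h0
  obtain ⟨m, c, -, hc, rfl⟩ := h0
  unfold gcdStarMonomial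
  rw [starMonomial_eq_monomial, monomial_dvd_monomial]
  refine ⟨Or.inr fun i => ?_, hc⟩
  have key : ∀ j ∈ K, m i ≤ (Fin.cons 1 (a j) : Fin (n + 1) → ℕ) i := by
    intro j hj
    have h1 := hp j hj
    rw [starMonomial_eq_monomial, monomial_dvd_monomial] at h1
    rcases h1.1 with h | h
    · exact absurd h one_ne_zero
    · exact h i
  refine Fin.cases (motive := fun i => (∀ j ∈ K, m i ≤ (Fin.cons 1 (a j) : Fin (n + 1) → ℕ) i) →
    m i ≤ Finsupp.equivFunOnFinite.symm
      (Fin.cons 1 (fun i => K.inf' _ (fun j => a j i)) : Fin (n + 1) → ℕ) i) ?_ ?_ i key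
  · intro h
    simpa using h j₀ hj₀
  · intro i h
    simp only [Finsupp.equivFunOnFinite_symm_apply_apply, Fin.cons_succ] at h ⊢
    exact Finset.le_inf' _ _ h

/-- The values of `e`, listed in increasing order with repetitions. -/
def sortedExponents {ι : Type*} [Fintype ι] (e : ι → ℕ) : List ℕ :=
  (Finset.univ.val.map e).sort (· ≤ ·)

/-- The differences of successive elements of the sorted list of the values of `e`. -/
def successiveDifferences {ι : Type*} [Fintype ι] (e : ι → ℕ) : List ℕ :=
  List.zipWith (fun x y => y - x) (sortedExponents e) (sortedExponents e).tail

/-- The collection of the monomials `x₀ x₁ ^ (a j 1) ⋯ xₙ ^ (a j n)` is `(1,1)`-free: for each of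
the variables `x₁, …, xₙ`, among the successive differences of the sorted exponents of this variable
the number `1` occurs at most once. -/
def IsOneOneFree {ι : Type*} [Fintype ι] {n : ℕ} (a : ι → Fin n → ℕ) : Prop :=
  ∀ i : Fin n, (successiveDifferences (fun j => a j i)).count 1 ≤ 1

end

/-!
The rank of a `(1,1)`-free star collection is the number of exponent vectors in the union of the
boxes `[0, a j]`. Boxes intersect in the boxes of the gcds, and a single star monomial is
`(1,1)`-free, so inclusion-exclusion gives the formula.

Dehomogenize by `x₀ = 1`: comparing coefficients, the points of a decomposition carry, for each `j`,
weights that extract the coefficient of `x ^ a j` from polynomials of degree at most `∑ i, a j i`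
(at most `∑ i, a j i + 1` if every form involves `x₀`). The monomials in the union of the boxes are
then linearly independent as functions on the points, whence the lower bound.

For the upper bound give each coordinate `i` distinct nodes `t i 0, t i 1, …` and use the grid
points indexed by the union of the boxes. Products of Lagrange weights on the box `[0, a j]` extract
the coefficient of `x ^ a j`. They do so in degree `∑ i, a j i + 1` because the nodes
`t i 0, …, t i (a j i)` are chosen to have sum `0`. Distinctness then forbids gaps of `1` between
the exponents at two places, since each such gap forces a node to vanish; this is what
`(1,1)`-freeness provides.
-/

section Extraction

open Finset

variable {κ σ K : Type*} [Fintype σ]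

/-- On polynomials of degree at most `D`, evaluation at the points `p k`, `k ∈ s`, with the weights
`w k` returns the coefficient of `x ^ b`. By linearity this is only required of the monomials. -/
def ExtractsCoeff [CommSemiring K] (s : Finset κ) (w : κ → K) (p : κ → σ → K) (b : σ → ℕ)
    (D : ℕ) : Prop :=
  ∀ β : σ → ℕ, ∑ i, β i ≤ D → ∑ k ∈ s, w k * ∏ i, p k i ^ β i = if β = b then 1 else 0

theorem ExtractsCoeff.indicator [CommSemiring K] {s t : Finset κ} {w : κ → K} {p : κ → σ → K}
    {b : σ → ℕ} {D : ℕ} (h : ExtractsCoeff s w p b D) (hst : s ⊆ t) :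
    ExtractsCoeff t ((s : Set κ).indicator w) p b D := by
  intro β hβ
  rw [← h β hβ]
  exact sum_indicator_subset_of_eq_zero w (fun k x => x * ∏ i, p k i ^ β i) hst
    fun _ => zero_mul _

theorem extractsCoeff_piFinset [DecidableEq σ] [CommSemiring K] {τ : Type*} {s : σ → Finset τ}
    {w t : σ → τ → K} {b : σ → ℕ}
    (h : ∀ i, ∀ m ≤ b i + 1, ∑ k ∈ s i, w i k * t i k ^ m = if m = b i then 1 else 0) :
    ExtractsCoeff (Fintype.piFinset s) (fun e => ∏ i, w i (e i)) (fun e i => t i (e i)) b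
      (∑ i, b i + 1) := by
  intro β hβ
  simp only [← prod_mul_distrib]
  rw [← prod_univ_sum s fun i k => w i k * t i k ^ β i]
  split_ifs with hβb
  · exact prod_eq_one fun i _ => by rw [hβb, h i _ (Nat.le_succ _), if_pos rfl]
  · obtain ⟨i, hne, hle⟩ : ∃ i, β i ≠ b i ∧ β i ≤ b i + 1 := by
      by_contra! hgap
      obtain ⟨i, hi⟩ := Function.ne_iff.1 hβb
      have hb : ∀ k, b k ≤ β k := fun k => by have := hgap k; omega
      have hrest := sum_le_sum fun k (_ : k ∈ univ.erase i) => hb k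
      have hi := hgap i hi
      rw [← add_sum_erase univ b (mem_univ i), ← add_sum_erase univ β (mem_univ i)] at hβ
      omega
    exact prod_eq_zero (mem_univ i) (by rw [h i _ hle, if_neg hne])

theorem linearIndependent_of_triangular_dual {ι α R M : Type*} [LinearOrder α] [CommRing R]
    [AddCommGroup M] [Module R M] {v : ι → M} (deg : ι → α) (φ : ι → Module.Dual R M)
    (hself : ∀ b, φ b (v b) = 1) (hlower : ∀ b e, e ≠ b → deg e ≤ deg b → φ b (v e) = 0) :
    LinearIndependent R v := by
  rw [linearIndependent_iff]
  intro l hl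
  by_contra hne
  obtain ⟨b, hb, hmax⟩ := l.support.exists_max_image deg (Finsupp.support_nonempty_iff.2 hne)
  have heval : φ b (Finsupp.linearCombination R v l) = l b := by
    rw [Finsupp.linearCombination_apply, map_finsuppSum, Finsupp.sum,
      sum_eq_single_of_mem b hb fun e he heb => by
        rw [map_smul, hlower b e heb (hmax e he), smul_zero],
      map_smul, hself, smul_eq_mul, mul_one]
  exact Finsupp.mem_support_iff.1 hb (by rw [← heval, hl, map_zero])

/-- The monomials in `S`, evaluated at the points of `s`, are linearly independent: `x ^ b` is
detected by multiplying with `x ^ (a - b)` and extracting the coefficient of `x ^ a`. -/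
theorem card_le_card_of_extractsCoeff [CommRing K] [Nontrivial K] {S : Finset (σ → ℕ)}
    {s : Finset κ} {p : κ → σ → K}
    (h : ∀ b ∈ S, ∃ a, b ≤ a ∧ ∃ w, ExtractsCoeff s w p a (∑ i, a i)) :
    #S ≤ #s := by
  choose a hba w hw using fun b : S => h b b.2
  let v : S → s → K := fun e k => ∏ i, p k i ^ e.1 i
  let φ : S → Module.Dual K (s → K) := fun b =>
    ∑ k : s, (w b k * ∏ i, p k i ^ (a b i - b.1 i)) • LinearMap.proj k
  have hφ (b e : S) (hdeg : ∑ i, e.1 i ≤ ∑ i, b.1 i) : φ b (v e) = if e = b then 1 else 0 := by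
    have hsum : ∑ i, (a b i - b.1 i + e.1 i) ≤ ∑ i, a b i := by
      have hab : ∑ i, (a b i - b.1 i) + ∑ i, b.1 i = ∑ i, a b i := by
        rw [← sum_add_distrib]
        exact sum_congr rfl fun i _ => Nat.sub_add_cancel (hba b i)
      rw [sum_add_distrib]
      omega
    have hiff : (fun i => a b i - b.1 i + e.1 i) = a b ↔ e = b := by
      simp only [funext_iff, Subtype.ext_iff]
      exact forall_congr' fun i => by
        have hi : b.1 i ≤ a b i := hba b i
        omega
    rw [← if_congr hiff rfl rfl, ← hw b _ hsum, ← sum_coe_sort s]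
    simp [φ, v, pow_add, prod_mul_distrib, mul_assoc]
  have hv : LinearIndependent K v :=
    linearIndependent_of_triangular_dual (fun e => ∑ i, e.1 i) φ
      (fun b => by rw [hφ b b le_rfl, if_pos rfl])
      fun b e hne hle => by rw [hφ b e hle, if_neg hne]
  simpa using hv.fintype_card_le_finrank

end Extraction

section Nodes

open Finset

/-- For `P` of degree `#s` this is interpolation of `P - c * nodal s v`, where `c` is the
coefficient of `X ^ #s` in `P`; the coefficient of degree `#s - 1` of the nodal polynomial is
`-∑ i ∈ s, v i`. -/
theorem sum_nodalWeight_mul_eval_eq_coeff {τ K : Type*} [DecidableEq τ] [Field K] {s : Finset τ}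
    {v : τ → K} (hv : Set.InjOn v s) (hs : s.Nonempty) (hsum : ∑ i ∈ s, v i = 0)
    {P : Polynomial K} (hP : P.natDegree ≤ #s) :
    ∑ i ∈ s, Lagrange.nodalWeight s v i * P.eval (v i) = P.coeff (#s - 1) := by
  let Q := P - Polynomial.C (P.coeff #s) * Lagrange.nodal s v
  have hQdeg : Q.degree < #s := by
    rw [Polynomial.degree_lt_iff_coeff_zero]
    intro m hm
    rcases hm.eq_or_lt with rfl | hm
    · have hlead : (Lagrange.nodal s v).coeff #s = 1 := by
        simpa [Polynomial.Monic, Polynomial.leadingCoeff] using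
          Lagrange.nodal_monic (s := s) (v := v)
      simp [Q, hlead]
    · have hnodal : (Lagrange.nodal s v).coeff m = 0 :=
        Polynomial.coeff_eq_zero_of_natDegree_lt (by simpa using hm)
      simp [Q, hnodal, Polynomial.coeff_eq_zero_of_natDegree_lt (hP.trans_lt hm)]
  have hQcoeff : Q.coeff (#s - 1) = P.coeff (#s - 1) := by
    have hnodal : (Lagrange.nodal s v).coeff (#s - 1) = 0 := by
      rw [Lagrange.nodal, Polynomial.prod_X_sub_C_coeff_card_pred s v hs.card_pos, hsum, neg_zero]
    simp [Q, hnodal]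
  have hQeval : ∀ i ∈ s, Q.eval (v i) = P.eval (v i) := fun i hi => by
    simp [Q, Lagrange.eval_nodal_at_node hi]
  rw [← hQcoeff, Lagrange.coeff_eq_sum hv hQdeg]
  refine sum_congr rfl fun i hi => ?_
  rw [hQeval i hi, Lagrange.nodalWeight, prod_inv_distrib, div_eq_inv_mul]

theorem extractsCoeff_Iic {σ K : Type*} [Fintype σ] [DecidableEq σ] [Field K] {t : σ → ℕ → K}
    (ht : ∀ i, Function.Injective (t i)) {b : σ → ℕ} (hsum : ∀ i, ∑ k ∈ Iic (b i), t i k = 0) :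
    ExtractsCoeff (Iic b) (fun e => ∏ i, Lagrange.nodalWeight (Iic (b i)) (t i) (e i))
      (fun e i => t i (e i)) b (∑ i, b i + 1) := by
  refine extractsCoeff_piFinset (s := fun i => Iic (b i)) fun i m hm => ?_
  have h := sum_nodalWeight_mul_eval_eq_coeff (ht i).injOn nonempty_Iic (hsum i)
    (P := Polynomial.X ^ m) (by simpa using hm)
  simpa [Polynomial.coeff_X_pow, eq_comm] using h

/-- Take `4 ^ m` off `Z`: then the difference at `k` is `0`, `-4 ^ k`, or between `3 * 4 ^ k` and
`4 ^ (k + 1)`, so that nonzero differences determine `k`. -/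
theorem exists_injective_sub_of_subsingleton {Z : Set ℕ}
    (hZ : {k | k ∈ Z ∧ k + 1 ∈ Z}.Subsingleton) :
    ∃ s : ℕ → ℤ, (∀ m ∈ Z, s m = 0) ∧ Function.Injective fun k => s (k + 1) - s k := by
  let s : ℕ → ℤ := Zᶜ.indicator fun m => 4 ^ m
  have hdiff (k : ℕ) : (s (k + 1) - s k = 0 ∧ k ∈ {k | k ∈ Z ∧ k + 1 ∈ Z}) ∨
      s (k + 1) - s k = -4 ^ k ∨
        3 * 4 ^ k ≤ s (k + 1) - s k ∧ s (k + 1) - s k ≤ 4 * 4 ^ k := by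
    have hpos : (0 : ℤ) < 4 ^ k := by positivity
    by_cases h₀ : k ∈ Z <;> by_cases h₁ : k + 1 ∈ Z <;> simp [s, h₀, h₁, pow_succ] <;> omega
  refine ⟨s, fun m hm => Set.indicator_of_notMem (not_not.2 hm) _,
    Function.Injective.of_lt_imp_ne fun k l hkl heq => ?_⟩
  have hpos : (0 : ℤ) < 4 ^ k := by positivity
  have hgrowth : (4 : ℤ) * 4 ^ k ≤ 4 ^ l := by
    rw [← pow_succ']
    exact pow_le_pow_right₀ (by norm_num) hkl
  rcases hdiff k with ⟨hk₀, hk⟩ | hk | hk <;> rcases hdiff l with ⟨hl₀, hl⟩ | hl | hl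
  case inl.inl => exact hkl.ne (hZ hk hl)
  all_goals omega

theorem exists_injective_sum_Iic_eq_zero {K : Type*} [Ring K] [CharZero K] {A : Set ℕ}
    (hA₀ : 0 ∉ A) (hA : {v | v ∈ A ∧ v + 1 ∈ A}.Subsingleton) :
    ∃ t : ℕ → K, Function.Injective t ∧ ∀ m ∈ A, ∑ k ∈ Iic m, t k = 0 := by
  let Z : Set ℕ := insert 0 (Nat.succ '' A)
  have hZ : {k | k ∈ Z ∧ k + 1 ∈ Z} ⊆ Nat.succ '' {v | v ∈ A ∧ v + 1 ∈ A} := by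
    rintro k ⟨rfl | ⟨v, hv, rfl⟩, hk⟩
    · exact absurd (by simpa [Z] using hk) hA₀
    · exact ⟨v, ⟨hv, by simpa [Z] using hk⟩, rfl⟩
  obtain ⟨s, hs, hinj⟩ := exists_injective_sub_of_subsingleton ((hA.image _).anti hZ)
  refine ⟨fun k => ((s (k + 1) - s k : ℤ) : K), Int.cast_injective.comp hinj, fun m hm => ?_⟩
  rw [← Nat.range_succ_eq_Iic, ← Int.cast_sum, sum_range_sub, hs _ (by simp [Z, hm]),
    hs 0 (by simp [Z]), sub_zero, Int.cast_zero]

end Nodes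

section OneOneFree

theorem mem_zip_tail_of_succ_mem {l : List ℕ} (hl : l.Pairwise (· ≤ ·)) {v : ℕ} (hv : v ∈ l)
    (hv' : v + 1 ∈ l) : (v, v + 1) ∈ l.zip l.tail := by
  induction l with
  | nil => simp at hv
  | cons x l ih =>
    rw [List.pairwise_cons] at hl
    obtain ⟨hx, hl⟩ := hl
    have hv'l : v + 1 ∈ l := by
      refine (List.mem_cons.1 hv').resolve_left fun hvx => ?_
      rcases List.mem_cons.1 hv with h | h
      · omega
      · have := hx v h
        omega
    cases l with
    | nil => simp at hv'l
    | cons y l =>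
      by_cases hvl : v ∈ y :: l
      · exact List.mem_cons_of_mem _ (ih hl hvl hv'l)
      · obtain rfl : v = x := (List.mem_cons.1 hv).resolve_right hvl
        obtain rfl : y = v + 1 := by
          have hvy := hx y List.mem_cons_self
          have hyv : y ≠ v := fun h => hvl (h ▸ List.mem_cons_self)
          rcases List.mem_cons.1 hv'l with h | h
          · exact h.symm
          · have := List.rel_of_pairwise_cons hl h
            omega
        exact List.mem_cons_self

theorem eq_of_count_map_le_one {α β : Type*} [DecidableEq β] {f : α → β} {c : β} {l : List α}
    (hl : (l.map f).count c ≤ 1) {x y : α} (hx : x ∈ l) (hy : y ∈ l) (hfx : f x = c)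
    (hfy : f y = c) : x = y := by
  classical
  rw [List.count, List.countP_map, List.countP_eq_length_filter] at hl
  refine Finset.card_le_one.1 ((List.toFinset_card_le _).trans hl) x ?_ y ?_ <;>
    simp [*]

theorem IsOneOneFree.subsingleton {ι : Type*} [Fintype ι] {n : ℕ} {a : ι → Fin n → ℕ}
    (hfree : IsOneOneFree a) (i : Fin n) :
    {v | v ∈ Set.range (a · i) ∧ v + 1 ∈ Set.range (a · i)}.Subsingleton := by
  have hmem (x : ℕ) : x ∈ sortedExponents (a · i) ↔ x ∈ Set.range (a · i) := by
    simp [sortedExponents]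
  simp only [← hmem]
  have hpair {v : ℕ} := mem_zip_tail_of_succ_mem (v := v)
    (Multiset.pairwise_sort (Finset.univ.val.map (a · i)) (· ≤ ·))
  have hcount := hfree i
  rw [successiveDifferences, ← List.map_uncurry_zip_eq_zipWith] at hcount
  rintro v ⟨hv, hv'⟩ w ⟨hw, hw'⟩
  exact congrArg Prod.fst (eq_of_count_map_le_one hcount (hpair hv hv') (hpair hw hw')
    (by simp) (by simp))

theorem isOneOneFree_const {n : ℕ} (b : Fin n → ℕ) : IsOneOneFree fun _ : Unit => b := by
  intro i
  simp [successiveDifferences, sortedExponents]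

end OneOneFree

section Decomposition

open Finset

/-- The exponent vector of `x₀ ^ d * x₁ ^ β₁ ⋯ xₙ ^ βₙ`. -/
noncomputable def consExponent {n : ℕ} (d : ℕ) (β : Fin n → ℕ) : Fin (n + 1) →₀ ℕ :=
  Finsupp.equivFunOnFinite.symm (Fin.cons d β : Fin (n + 1) → ℕ)

theorem forall_consExponent {n : ℕ} {P : (Fin (n + 1) →₀ ℕ) → Prop} :
    (∀ s, P s) ↔ ∀ d β, P (consExponent d β) := by
  refine ⟨fun h d β => h _, fun h s => ?_⟩
  simpa [consExponent] using h (s 0) (Fin.tail s)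

theorem consExponent_inj {n : ℕ} {d d' : ℕ} {β β' : Fin n → ℕ} :
    consExponent d β = consExponent d' β' ↔ d = d' ∧ β = β' := by
  simp [consExponent, Fin.cons_inj]

theorem coeff_consExponent_pow {R : Type*} [CommSemiring R] {n : ℕ} (l : Fin (n + 1) → R) (d m : ℕ)
    (β : Fin n → ℕ) :
    coeff (consExponent d β) ((∑ i, l i • X i : MvPolynomial (Fin (n + 1)) R) ^ m) =
      if d + ∑ i, β i = m then
        (consExponent d β).multinomial * (l 0 ^ d * ∏ i : Fin n, l i.succ ^ β i) else 0 := by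
  rw [coeff_linearCombination_X_pow_of_fintype, Finsupp.sum_fintype _ _ fun _ => rfl,
    Finsupp.prod_fintype _ _ fun _ => pow_zero _, Fin.sum_univ_succ, Fin.prod_univ_succ]
  simp only [consExponent, Finsupp.equivFunOnFinite_symm_apply_apply, Fin.cons_zero, Fin.cons_succ]

theorem coeff_consExponent_starMonomial {n : ℕ} (b : Fin n → ℕ) (d : ℕ) (β : Fin n → ℕ) :
    coeff (consExponent d β) (starMonomial b) = if d = 1 ∧ β = b then 1 else 0 := by
  rw [starMonomial_eq_monomial, ← consExponent, coeff_monomial]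
  simp only [consExponent_inj, eq_comm]

theorem totalDegree_starMonomial {n : ℕ} (b : Fin n → ℕ) :
    (starMonomial b).totalDegree = 1 + ∑ i, b i := by
  rw [starMonomial_eq_monomial, totalDegree_monomial _ one_ne_zero]
  simp [Finsupp.sum_fintype, Fin.sum_univ_succ]

theorem starMonomial_eq_sum_pow_iff {κ : Type*} {n : ℕ} {b : Fin n → ℕ} {s : Finset κ} {c : κ → ℂ}
    {l : κ → Fin (n + 1) → ℂ} :
    starMonomial b = ∑ k ∈ s, C (c k) * (∑ i, l k i • X i) ^ (1 + ∑ i, b i) ↔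
      ∀ d β, d + ∑ i, β i = 1 + ∑ i, b i →
        ∑ k ∈ s, c k * (l k 0 ^ d * ∏ i : Fin n, l k i.succ ^ β i) =
          if β = b then ((consExponent 1 b).multinomial : ℂ)⁻¹ else 0 := by
  rw [MvPolynomial.ext_iff, forall_consExponent]
  refine forall₂_congr fun d β => ?_
  simp only [coeff_consExponent_starMonomial, coeff_sum, coeff_C_mul, coeff_consExponent_pow]
  by_cases hd : d + ∑ i, β i = 1 + ∑ i, b i
  · have hM : ((consExponent d β).multinomial : ℂ) ≠ 0 :=
      Nat.cast_ne_zero.2 (Nat.multinomial_pos _ _).ne'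
    simp only [hd, if_true, true_imp_iff, mul_left_comm (c _), ← mul_sum]
    by_cases hβ : β = b
    · subst hβ
      obtain rfl : d = 1 := by omega
      simp only [and_self, if_true]
      rw [eq_comm, mul_eq_one_iff_inv_eq₀ hM, eq_comm]
    · simp [hβ, hM, eq_comm]
  · have hne : ¬(d = 1 ∧ β = b) := by
      rintro ⟨rfl, rfl⟩
      exact hd rfl
    simp [hd, hne]

/-- The linear form `x₀ + p₁ x₁ + ⋯ + pₙ xₙ` belonging to the point `p` of affine space. -/
noncomputable def affineForm {n : ℕ} (p : Fin n → ℂ) : MvPolynomial (Fin (n + 1)) ℂ :=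
  ∑ i, (Fin.cons 1 p : Fin (n + 1) → ℂ) i • X i

theorem isHomogeneous_affineForm {n : ℕ} (p : Fin n → ℂ) : (affineForm p).IsHomogeneous 1 :=
  IsHomogeneous.sum _ _ _ fun i _ => by
    rw [smul_eq_C_mul]
    exact isHomogeneous_C_mul_X _ _

theorem ExtractsCoeff.starMonomial_eq {κ : Type*} {n : ℕ} {b : Fin n → ℕ} {s : Finset κ}
    {w : κ → ℂ} {p : κ → Fin n → ℂ} (h : ExtractsCoeff s w p b (∑ i, b i + 1)) :
    starMonomial b = ∑ k ∈ s, C (((consExponent 1 b).multinomial : ℂ)⁻¹ * w k) *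
      affineForm (p k) ^ (1 + ∑ i, b i) := by
  refine starMonomial_eq_sum_pow_iff.2 fun d β hd => ?_
  simp only [Fin.cons_zero, Fin.cons_succ, one_pow, one_mul, mul_assoc, ← mul_sum]
  rw [h β (by omega), mul_ite, mul_one, mul_zero]

/-- Forms without `x₀` drop out because only coefficients of monomials divisible by `x₀` are
compared; for them `l k i.succ / l k 0 = 0` and the weight is `0` as well. -/
theorem extractsCoeff_of_starMonomial_eq {κ : Type*} {n : ℕ} {b : Fin n → ℕ} {s : Finset κ}
    {c : κ → ℂ} {l : κ → Fin (n + 1) → ℂ}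
    (h : starMonomial b = ∑ k ∈ s, C (c k) * (∑ i, l k i • X i) ^ (1 + ∑ i, b i)) :
    ExtractsCoeff s (fun k => (consExponent 1 b).multinomial * (c k * l k 0 ^ (1 + ∑ i, b i)))
      (fun k i => l k i.succ / l k 0) b (∑ i, b i) := by
  intro β hβ
  obtain ⟨d, hd⟩ : ∃ d, d + 1 + ∑ i, β i = 1 + ∑ i, b i := ⟨∑ i, b i - ∑ i, β i, by omega⟩
  have hM : ((consExponent 1 b).multinomial : ℂ) ≠ 0 :=
    Nat.cast_ne_zero.2 (Nat.multinomial_pos _ _).ne'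
  have hdehom (k : κ) : l k 0 ^ (1 + ∑ i, b i) * ∏ i : Fin n, (l k i.succ / l k 0) ^ β i =
      l k 0 ^ (d + 1) * ∏ i : Fin n, l k i.succ ^ β i := by
    by_cases h₀ : l k 0 = 0
    · simp [h₀, add_comm 1]
    · simp only [div_pow, prod_div_distrib, prod_pow_eq_pow_sum]
      rw [← hd, pow_add]
      field_simp
  simp only [mul_assoc, hdehom, ← mul_sum]
  rw [starMonomial_eq_sum_pow_iff.1 h (d + 1) β hd, mul_ite, mul_inv_cancel₀ hM, mul_zero]

theorem hasSimultaneousDecomposition_card_of_extractsCoeff {ι κ : Type*} {n : ℕ}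
    {a : ι → Fin n → ℕ} {s : Finset κ} {p : κ → Fin n → ℂ}
    (h : ∀ j, ∃ w, ExtractsCoeff s w p (a j) (∑ i, a j i + 1)) :
    HasSimultaneousDecomposition (fun j => starMonomial (a j)) #s := by
  choose w hw using h
  refine ⟨fun k => affineForm (p (s.equivFin.symm k)), fun k => isHomogeneous_affineForm _,
    fun j => ⟨fun k => ((consExponent 1 (a j)).multinomial : ℂ)⁻¹ * w j (s.equivFin.symm k), ?_⟩⟩
  rw [totalDegree_starMonomial]
  refine (hw j).starMonomial_eq.trans ?_
  rw [← sum_coe_sort, ← s.equivFin.symm.sum_comp]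

theorem exists_eq_sum_smul_X {σ R : Type*} [Fintype σ] [CommSemiring R] {L : MvPolynomial σ R}
    (hL : L.IsHomogeneous 1) : ∃ l : σ → R, L = ∑ i, l i • X i := by
  rw [← mem_homogeneousSubmodule, homogeneousSubmodule_one_eq_span_X,
    Submodule.mem_span_range_iff_exists_fun] at hL
  exact hL.imp fun l hl => hl.symm

theorem HasSimultaneousDecomposition.exists_extractsCoeff {ι : Type*} {n : ℕ}
    {a : ι → Fin n → ℕ} {r : ℕ}
    (h : HasSimultaneousDecomposition (fun j => starMonomial (a j)) r) :
    ∃ p : Fin r → Fin n → ℂ, ∀ j, ∃ w, ExtractsCoeff univ w p (a j) (∑ i, a j i) := by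
  obtain ⟨L, hL, hF⟩ := h
  choose l hl using fun k => exists_eq_sum_smul_X (hL k)
  obtain rfl : L = fun k => ∑ i, l k i • X i := funext hl
  refine ⟨fun k i => l k i.succ / l k 0, fun j => ?_⟩
  obtain ⟨c, hc⟩ := hF j
  rw [totalDegree_starMonomial] at hc
  exact ⟨_, extractsCoeff_of_starMonomial_eq hc⟩

end Decomposition

section Rank

open Finset

theorem inf'_Iic {ι α : Type*} [SemilatticeInf α] [LocallyFiniteOrderBot α] [DecidableEq α]
    (K : Finset ι) (hK : K.Nonempty) (f : ι → α) :
    K.inf' hK (fun j => Iic (f j)) = Iic (K.inf' hK f) := by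
  ext e
  simp [mem_inf']

variable {ι : Type*} [Fintype ι] {n : ℕ} {a : ι → Fin n → ℕ}

theorem HasSimultaneousDecomposition.card_biUnion_Iic_le {r : ℕ}
    (h : HasSimultaneousDecomposition (fun j => starMonomial (a j)) r) :
    #(univ.biUnion fun j => Iic (a j)) ≤ r := by
  obtain ⟨p, hp⟩ := h.exists_extractsCoeff
  rw [← card_fin r]
  refine card_le_card_of_extractsCoeff (p := p) fun b hb => ?_
  obtain ⟨j, -, hbj⟩ := mem_biUnion.1 hb
  exact ⟨a j, mem_Iic.1 hbj, hp j⟩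

theorem IsOneOneFree.hasSimultaneousDecomposition (hfree : IsOneOneFree a)
    (ha : ∀ j i, 1 ≤ a j i) :
    HasSimultaneousDecomposition (fun j => starMonomial (a j))
      #(univ.biUnion fun j => Iic (a j)) := by
  have hpos (i : Fin n) : 0 ∉ Set.range (a · i) := by
    rintro ⟨j, hj⟩
    exact Nat.one_le_iff_ne_zero.1 (ha j i) hj
  choose t ht hsum using fun i =>
    exists_injective_sum_Iic_eq_zero (K := ℂ) (hpos i) (hfree.subsingleton i)
  refine hasSimultaneousDecomposition_card_of_extractsCoeff (p := fun e i => t i (e i)) fun j =>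
    ⟨_, (extractsCoeff_Iic ht fun i => hsum i _ ⟨j, rfl⟩).indicator ?_⟩
  exact subset_biUnion_of_mem (fun j => Iic (a j)) (mem_univ j)

theorem IsOneOneFree.simultaneousWaringRank_eq (hfree : IsOneOneFree a)
    (ha : ∀ j i, 1 ≤ a j i) :
    simultaneousWaringRank (fun j => starMonomial (a j)) = #(univ.biUnion fun j => Iic (a j)) :=
  have h := hfree.hasSimultaneousDecomposition ha
  le_antisymm (Nat.sInf_le h) (le_csInf ⟨_, h⟩ fun _ hr => hr.card_biUnion_Iic_le)

theorem waringRank_starMonomial {b : Fin n → ℕ} (hb : ∀ i, 1 ≤ b i) :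
    waringRank (starMonomial b) = #(Iic b) := by
  simpa [waringRank] using (isOneOneFree_const b).simultaneousWaringRank_eq fun _ => hb

end Rank

theorem mainTheorem3 {ι : Type*} [Fintype ι] (n : ℕ) (a : ι → Fin n → ℕ)
    (ha : ∀ j i, 1 ≤ a j i) (hfree : IsOneOneFree a) :
    (∃ r, HasSimultaneousDecomposition (fun j => starMonomial (a j)) r) ∧
    (∀ K : {K : Finset ι // K.Nonempty},
      ∃ r, HasSimultaneousDecomposition (fun _ : Unit => gcdStarMonomial a K.1 K.2) r) ∧
    (simultaneousWaringRank (fun j => starMonomial (a j)) : ℤ) =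
      ∑ K : {K : Finset ι // K.Nonempty},
        (-1 : ℤ) ^ (K.1.card + 1) * (waringRank (gcdStarMonomial a K.1 K.2) : ℤ) := by
  have hgcd (K : {K : Finset ι // K.Nonempty}) (i : Fin n) : 1 ≤ K.1.inf' K.2 (a · i) :=
    Finset.le_inf' _ _ fun j _ => ha j i
  have hrank (K : {K : Finset ι // K.Nonempty}) :
      waringRank (gcdStarMonomial a K.1 K.2) =
        (K.1.inf' K.2 fun j => Finset.Iic (a j)).card := by
    rw [gcdStarMonomial, waringRank_starMonomial (hgcd K), inf'_Iic]
    congr; ext; simp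
  refine ⟨⟨_, hfree.hasSimultaneousDecomposition ha⟩,
    fun K => ⟨_, (isOneOneFree_const _).hasSimultaneousDecomposition fun _ => hgcd K⟩, ?_⟩
  rw [hfree.simultaneousWaringRank_eq ha, Finset.inclusion_exclusion_card_biUnion]
  refine Fintype.sum_equiv (Equiv.subtypeEquivRight (by simp)) _ _ fun K => ?_
  rw [hrank]
  rfl
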